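/- Let $T\in\mathbb R$, $-\infty\le\bar T<T$, let $A(t),C(t)\in\mathbb R^{n\times n}$ and $\sigma(t)\in\mathbb R^{n\times m}$ be given for $t\in(\bar T,T]$, with $C(t)$ symmetric and $\sigma$ measurable, and put $\Sigma(t)=\sigma(t)\sigma(t)'$, where $'$ denotes the transpose. Let $P_T,Q_T\in\mathbb R^{n\times n}$ be symmetric and $S_T\in\mathbb R^{n\times n}$ invertible. Differential equations are understood in the integrated (Carathéodory) sense. Assume (A.1) $A,C,\Sigma$ are piecewise continuous and locally bounded on $(\bar T,T]$; the Riccati equation $-\dot P_t=A(t)'P_t+P_tA(t)+C(t)+P_t\Sigma(t)P_t$ has a solution on $(\bar T,T]$ with terminal value $P_T$; and for all $x,y\in\mathbb R^n$ and $\bar T<t_1<t_2\le T$ there is $u\in L_2(t_1,t_2;\mathbb R^m)$ for which the solution of $\dot x_t=A(t)x_t+\sigma(t)u_t$, $x_{t_1}=x$, satisfies $x_{t_2}=y$. For $\bar T<t_1\le t_2\le T$ and $x,y\in\mathbb R^n$ define the max-plus kernel $$I_{t_1}^{t_2}(x,y)=\sup\Big\{\int_{t_1}^{t_2}\big(\tfrac12x_t'C(t)x_t-\tfrac12|u_t|^2\big)\,dt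 \;:\; u\in L_2(t_1,t_2;\mathbb R^m),\ \dot x_t=A(t)x_t+\sigma(t)u_t,\ x_{t_1}=x,\ x_{t_2}=y\Big\}\in[-\infty,\infty],$$ with $\sup\emptyset=-\infty$, and for $z\in\mathbb R^n$ and $t\in(\bar T,T]$ define the value function $$V_t^z(x)=\sup_{u\in L_2(t,T;\mathbb R^m)}\Big\{\int_t^T\big(\tfrac12x_s'C(s)x_s-\tfrac12|u_s|^2\big)\,ds+\tfrac12x_T'P_Tx_T+x_T'S_Tz+\tfrac12z'Q_Tz\Big\},\qquad \dot x_s=A(s)x_s+\sigma(s)u_s,\ x_t=x.$$ Then the following hold. 1. For all $x,y\in\mathbb R^n$ and $\bar T<t_1\le t_2\le T$, $$I_{t_1}^{t_2}(x,y)=\inf_{z\in\mathbb R^n}\big[V_{t_1}^z(x)-V_{t_2}^z(y)\big]$$ (both sides may be $-\infty$ when $t_1=t_2$). 2. The bivariate differential Riccati equation $$-\dot P_t=A(t)'P_t+P_tA(t)+C(t)+P_t\Sigma(t)P_t,\qquad -\dot S_t=(A(t)+\Sigma(t)P_t)'S_t,\qquad -\dot Q_t=S_t'\Sigma(t)S_t$$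 has a solution on $(\bar T,T]$ with terminal values $P_T,S_T,Q_T$ at $t=T$. For every such solution $(P_t,S_t,Q_t)$ one has $V_t^z(x)=\tfrac12x'P_tx+x'S_tz+\tfrac12z'Q_tz$ for all $t\in(\bar T,T]$ and $x,z\in\mathbb R^n$; and for $\bar T<t_1<t_2\le T$ the matrix $Q_{t_1}-Q_{t_2}$ is invertible and, for all $x,y\in\mathbb R^n$, $$I_{t_1}^{t_2}(x,y)=\tfrac12x'I_{11}x+x'I_{12}y+\tfrac12y'I_{22}y,$$ where $$I_{11}=P_{t_1}-S_{t_1}(Q_{t_1}-Q_{t_2})^{-1}S_{t_1}',\quad I_{12}=S_{t_1}(Q_{t_1}-Q_{t_2})^{-1}S_{t_2}',\quad I_{22}=-P_{t_2}-S_{t_2}(Q_{t_1}-Q_{t_2})^{-1}S_{t_2}'.$$ -/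

import Mathlib

open Set MeasureTheory Matrix

noncomputable section

namespace MaxPlusRiccati

/-- The time interval `(T̄, T]`; `T̄ = -∞` is allowed. -/
def timeInterval (Tbar : EReal) (T : ℝ) : Set ℝ :=
  {t : ℝ | Tbar < (t : EReal) ∧ t ≤ T}

/-- Locally bounded, and on every compact subinterval continuous off a finite set
(existence of one-sided limits at the exceptional points is not required). -/
def PiecewiseContinuousLocallyBounded (J : Set ℝ) (f : ℝ → ℝ) : Prop :=
  ∀ a ∈ J, ∀ b ∈ J,
    (∃ F : Set ℝ, F.Finite ∧ ContinuousOn f (Icc a b \ F)) ∧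
    (∃ M : ℝ, ∀ t ∈ Icc a b, |f t| ≤ M)

/-- `f` is locally absolutely continuous on the interval `J` with `f' = g` almost everywhere,
in integrated form.  This is the (Carathéodory) meaning of the differential equations below,
whose coefficients may jump. -/
def IsPrimitiveOn (J : Set ℝ) (f g : ℝ → ℝ) : Prop :=
  ∀ a ∈ J, ∀ b ∈ J, IntervalIntegrable g volume a b ∧ f b - f a = ∫ t in a..b, g t

/-- The matrix differential equation `-dX/dt = G` on `J`, entrywise. -/
def MatrixBackwardODE {n : ℕ} (J : Set ℝ) (X G : ℝ → Matrix (Fin n) (Fin n) ℝ) : Prop :=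
  ∀ i j, IsPrimitiveOn J (fun t => X t i j) (fun t => -(G t i j))

/-- The differential Riccati equation `-dP/dt = A'P + PA + C + PΣP` on `J`, with `Σ = σσ'`. -/
def IsRiccatiSolution {n m : ℕ} (J : Set ℝ) (A C : ℝ → Matrix (Fin n) (Fin n) ℝ)
    (σ : ℝ → Matrix (Fin n) (Fin m) ℝ) (P : ℝ → Matrix (Fin n) (Fin n) ℝ) : Prop :=
  MatrixBackwardODE J P
    (fun t => (A t)ᵀ * P t + P t * A t + C t + P t * (σ t * (σ t)ᵀ) * P t)

/-- The bivariate differential Riccati equation on `J`, with `Σ = σσ'`: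
`-dP/dt = A'P + PA + C + PΣP`, `-dS/dt = (A + ΣP)'S`, `-dQ/dt = S'ΣS`. -/
structure IsBivariateRiccatiSolution {n m : ℕ} (J : Set ℝ)
    (A C : ℝ → Matrix (Fin n) (Fin n) ℝ) (σ : ℝ → Matrix (Fin n) (Fin m) ℝ)
    (P S Q : ℝ → Matrix (Fin n) (Fin n) ℝ) : Prop where
  riccati : IsRiccatiSolution J A C σ P
  linear : MatrixBackwardODE J S (fun t => (A t + σ t * (σ t)ᵀ * P t)ᵀ * S t)
  quadrature : MatrixBackwardODE J Q (fun t => (S t)ᵀ * (σ t * (σ t)ᵀ) * S t)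

/-- `u ∈ L₂(t₁, t₂; ℝᵐ)` and `x` solves `dx/dt = A x + σ u` on `[t₁, t₂]`.
(All norms on `ℝᵐ` are equivalent, so the choice does not matter for `MemLp`.) -/
structure IsControlledTrajectory {n m : ℕ} (A : ℝ → Matrix (Fin n) (Fin n) ℝ)
    (σ : ℝ → Matrix (Fin n) (Fin m) ℝ) (t₁ t₂ : ℝ)
    (u : ℝ → Fin m → ℝ) (x : ℝ → Fin n → ℝ) : Prop where
  control_mem : MemLp u 2 (volume.restrict (Icc t₁ t₂))
  dynamics : ∀ i, IsPrimitiveOn (Icc t₁ t₂) (fun t => x t i)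
    (fun t => (A t *ᵥ x t + σ t *ᵥ u t) i)

/-- The running payoff `∫ (½ x'Cx - ½ |u|²) dt` over `[t₁, t₂]`. -/
def runningPayoff {n m : ℕ} (C : ℝ → Matrix (Fin n) (Fin n) ℝ) (t₁ t₂ : ℝ)
    (u : ℝ → Fin m → ℝ) (x : ℝ → Fin n → ℝ) : ℝ :=
  ∫ t in t₁..t₂, ((1 / 2) * (x t ⬝ᵥ (C t *ᵥ x t)) - (1 / 2) * (u t ⬝ᵥ u t))

/-- The bivariate quadratic `½ x'Px + x'Sz + ½ z'Qz`. -/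
def bivariateQuadratic {n : ℕ} (P S Q : Matrix (Fin n) (Fin n) ℝ) (x z : Fin n → ℝ) : ℝ :=
  (1 / 2) * (x ⬝ᵥ (P *ᵥ x)) + x ⬝ᵥ (S *ᵥ z) + (1 / 2) * (z ⬝ᵥ (Q *ᵥ z))

/-- The value function `V^z_t(x)`: the supremum over `u ∈ L₂(t, T)` of the running payoff plus the
terminal payoff `φ^z(x_T)`, along the trajectory started at `x_t = x`. -/
def valueFunction {n m : ℕ} (T : ℝ) (A C : ℝ → Matrix (Fin n) (Fin n) ℝ)
    (σ : ℝ → Matrix (Fin n) (Fin m) ℝ) (PT ST QT : Matrix (Fin n) (Fin n) ℝ)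
    (z : Fin n → ℝ) (t : ℝ) (x : Fin n → ℝ) : EReal :=
  sSup {r : EReal | ∃ (u : ℝ → Fin m → ℝ) (ξ : ℝ → Fin n → ℝ),
    IsControlledTrajectory A σ t T u ξ ∧ ξ t = x ∧
    r = ((runningPayoff C t T u ξ + bivariateQuadratic PT ST QT (ξ T) z : ℝ) : EReal)}

/-- The max-plus kernel `I_{t₁}^{t₂}(x, y)`: the supremum of the running payoff over the controls
that steer `x` to `y`; it is `-∞` if there are none (`sSup ∅ = ⊥`). -/
def maxPlusKernel {n m : ℕ} (A C : ℝ → Matrix (Fin n) (Fin n) ℝ)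
    (σ : ℝ → Matrix (Fin n) (Fin m) ℝ) (t₁ t₂ : ℝ) (x y : Fin n → ℝ) : EReal :=
  sSup {r : EReal | ∃ (u : ℝ → Fin m → ℝ) (ξ : ℝ → Fin n → ℝ),
    IsControlledTrajectory A σ t₁ t₂ u ξ ∧ ξ t₁ = x ∧ ξ t₂ = y ∧
    r = ((runningPayoff C t₁ t₂ u ξ : ℝ) : EReal)}

/-- The standing assumptions on the coefficients and on the terminal value `PT`.
`Σ = σσ'` is positive semidefinite by construction. -/
structure StandingAssumptions {n m : ℕ} (Tbar : EReal) (T : ℝ)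
    (A C : ℝ → Matrix (Fin n) (Fin n) ℝ) (σ : ℝ → Matrix (Fin n) (Fin m) ℝ)
    (PT : Matrix (Fin n) (Fin n) ℝ) : Prop where
  symm_C : ∀ t ∈ timeInterval Tbar T, (C t).IsSymm
  regular_A : ∀ i j, PiecewiseContinuousLocallyBounded (timeInterval Tbar T) (fun t => A t i j)
  regular_C : ∀ i j, PiecewiseContinuousLocallyBounded (timeInterval Tbar T) (fun t => C t i j)
  regular_Sigma : ∀ i j, PiecewiseContinuousLocallyBounded (timeInterval Tbar T)
    (fun t => (σ t * (σ t)ᵀ) i j)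
  measurable_sigma : ∀ i j,
    AEMeasurable (fun t => σ t i j) (volume.restrict (timeInterval Tbar T))
  riccati_exists : ∃ P : ℝ → Matrix (Fin n) (Fin n) ℝ,
    IsRiccatiSolution (timeInterval Tbar T) A C σ P ∧ P T = PT
  controllable : ∀ t₁ ∈ timeInterval Tbar T, ∀ t₂ ∈ timeInterval Tbar T, t₁ < t₂ →
    ∀ x y : Fin n → ℝ, ∃ (u : ℝ → Fin m → ℝ) (ξ : ℝ → Fin n → ℝ),
      IsControlledTrajectory A σ t₁ t₂ u ξ ∧ ξ t₁ = x ∧ ξ t₂ = y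

/-- `I₁₁ = P_{t₁} - S_{t₁} (Q_{t₁} - Q_{t₂})⁻¹ S_{t₁}'`. -/
def kernel11 {n : ℕ} (P S Q : ℝ → Matrix (Fin n) (Fin n) ℝ) (t₁ t₂ : ℝ) :
    Matrix (Fin n) (Fin n) ℝ :=
  P t₁ - S t₁ * (Q t₁ - Q t₂)⁻¹ * (S t₁)ᵀ

/-- `I₁₂ = S_{t₁} (Q_{t₁} - Q_{t₂})⁻¹ S_{t₂}'`. -/
def kernel12 {n : ℕ} (S Q : ℝ → Matrix (Fin n) (Fin n) ℝ) (t₁ t₂ : ℝ) :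
    Matrix (Fin n) (Fin n) ℝ :=
  S t₁ * (Q t₁ - Q t₂)⁻¹ * (S t₂)ᵀ

/-- `I₂₂ = -P_{t₂} - S_{t₂} (Q_{t₁} - Q_{t₂})⁻¹ S_{t₂}'`. -/
def kernel22 {n : ℕ} (P S Q : ℝ → Matrix (Fin n) (Fin n) ℝ) (t₁ t₂ : ℝ) :
    Matrix (Fin n) (Fin n) ℝ :=
  -P t₂ - S t₂ * (Q t₁ - Q t₂)⁻¹ * (S t₂)ᵀ

end MaxPlusRiccati

end

/-!
The idea is to complete squares. Let `(P, S, Q)` solve the bivariate Riccati equation and put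
`W_t(x, z) = ½ x'P_t x + x'S_t z + ½ z'Q_t z`. Along a controlled trajectory,

  `∫ (½ ξ'Cξ - ½ |u|²) + W_{t₂}(ξ_{t₂}, z) = W_{t₁}(ξ_{t₁}, z) - ½ ∫ |u - σ'(Pξ + Sz)|²`

for every `z` (`runningPayoff_add_bivariateQuadratic`). Dropping the last term gives weak duality
(`IsBivariateRiccatiSolution.runningPayoff_le`): the payoff of any trajectory from `x` to `y` is at
most `W_{t₁}(x, z) - W_{t₂}(y, z)`. Equality holds for the optimal feedback `u = σ'(Pξ + Sz)`. Its
closed loop is explicit, since `S'ξ + Qz` is constant along it and `S'` is inverted by the dual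
fundamental matrix (`IsBivariateRiccatiSolution.exists_optimal_trajectory`).

With `t₂ = T` this identifies the value function with `W`. For `t₁ < t₂`, controllability and weak
duality make `Q_{t₁} - Q_{t₂}` invertible (`IsBivariateRiccatiSolution.isUnit_Q_sub`). Hence for any
`x, y` there is exactly one `z` whose closed loop steers `x` to `y`, namely
`z = (Q_{t₁} - Q_{t₂})⁻¹ (S_{t₂}'y - S_{t₁}'x)`. For this `z` weak duality is an equality, so it
both attains the supremum that defines the kernel and minimizes `W_{t₁}(x, z) - W_{t₂}(y, z)`;
substituting it gives the formula for the kernel.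

The differential equations are Carathéodory equations with coefficients that are only measurable
and locally bounded. The one existence result needed is for linear equations, by the Peano–Baker
series (`exists_linear_solution`); every invariance or uniqueness argument exhibits an expression
with zero derivative by the product rule for absolutely continuous functions
(`IsPrimitiveOn.mul`). In particular the symmetry of `P` (`IsRiccatiSolution.isSymm`) and the
invertibility of `S` are obtained in this way.
-/

namespace MaxPlusRiccati

/-! ### Calculus of primitives -/

namespace IsPrimitiveOn

variable {J J' : Set ℝ} {f g f' g' : ℝ → ℝ}

theorem mono (h : IsPrimitiveOn J f f') (hJ : J' ⊆ J) : IsPrimitiveOn J' f f' :=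
  fun a ha b hb => h a (hJ ha) b (hJ hb)

theorem congr_deriv [J.OrdConnected] (h : IsPrimitiveOn J f f') (hfg : ∀ t ∈ J, f' t = g' t) :
    IsPrimitiveOn J f g' := by
  intro a ha b hb
  have hsub : uIcc a b ⊆ J := OrdConnected.uIcc_subset ‹_› ha hb
  obtain ⟨h1, h2⟩ := h a ha b hb
  refine ⟨h1.congr fun t ht => hfg t (hsub (uIoc_subset_uIcc ht)), ?_⟩
  rw [h2]
  exact intervalIntegral.integral_congr fun t ht => hfg t (hsub ht)

theorem const (c : ℝ) : IsPrimitiveOn J (fun _ => c) (fun _ => 0) := by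
  intro a _ b _
  simp

theorem add (hf : IsPrimitiveOn J f f') (hg : IsPrimitiveOn J g g') :
    IsPrimitiveOn J (fun t => f t + g t) (fun t => f' t + g' t) := by
  intro a ha b hb
  obtain ⟨h1, h2⟩ := hf a ha b hb
  obtain ⟨h3, h4⟩ := hg a ha b hb
  refine ⟨h1.add h3, ?_⟩
  rw [intervalIntegral.integral_add h1 h3, ← h2, ← h4]
  ring

theorem sum {ι : Type*} {s : Finset ι} {F F' : ι → ℝ → ℝ}
    (h : ∀ i ∈ s, IsPrimitiveOn J (F i) (F' i)) :
    IsPrimitiveOn J (fun t => ∑ i ∈ s, F i t) (fun t => ∑ i ∈ s, F' i t) := by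
  induction s using Finset.cons_induction with
  | empty => simpa using const 0
  | cons i s hi ih =>
    simp only [Finset.sum_cons]
    exact (h i (Finset.mem_cons_self i s)).add
      (ih fun j hj => h j (Finset.mem_cons_of_mem hj))

theorem continuousOn_uIcc [J.OrdConnected] (h : IsPrimitiveOn J f f') {a b : ℝ} (ha : a ∈ J)
    (hb : b ∈ J) : ContinuousOn f (uIcc a b) := by
  have hsub : uIcc a b ⊆ J := OrdConnected.uIcc_subset ‹_› ha hb
  refine ((intervalIntegral.continuousOn_primitive_interval' (h a ha b hb).1
    left_mem_uIcc).const_add (f a)).congr fun t ht => ?_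
  linarith [(h a ha t (hsub ht)).2]

/-- On a compact subinterval a primitive coincides with an indefinite integral, hence is absolutely
continuous with the expected derivative almost everywhere. -/
theorem exists_absolutelyContinuousOnInterval [J.OrdConnected] (h : IsPrimitiveOn J f f')
    {a b : ℝ} (ha : a ∈ J) (hb : b ∈ J) :
    ∃ F : ℝ → ℝ, AbsolutelyContinuousOnInterval F a b ∧ EqOn F f (uIcc a b) ∧
      ∀ᵐ t, t ∈ uIcc a b → deriv F t = f' t := by
  have hsub : uIcc a b ⊆ J := OrdConnected.uIcc_subset ‹_› ha hb
  have hint := (h a ha b hb).1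
  refine ⟨fun t => f a + ∫ s in a..t, f' s, ?_, fun t ht => ?_, ?_⟩
  · have hconst : AbsolutelyContinuousOnInterval (fun _ : ℝ => f a) a b :=
      ((LipschitzWith.const (f a)).lipschitzOnWith
        (s := uIcc a b)).absolutelyContinuousOnInterval
    exact hconst.add (hint.absolutelyContinuousOnInterval_intervalIntegral left_mem_uIcc)
  · have := (h a ha t (hsub ht)).2
    simp only
    linarith
  · filter_upwards [hint.ae_hasDerivAt_integral] with t ht hmem
    exact ((ht hmem a left_mem_uIcc).const_add (f a)).deriv

/-- The product rule. -/
theorem mul [J.OrdConnected] (hf : IsPrimitiveOn J f f') (hg : IsPrimitiveOn J g g') :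
    IsPrimitiveOn J (fun t => f t * g t) (fun t => f' t * g t + f t * g' t) := by
  intro a ha b hb
  refine ⟨((hf a ha b hb).1.mul_continuousOn (hg.continuousOn_uIcc ha hb)).add
    ((hg a ha b hb).1.continuousOn_mul (hf.continuousOn_uIcc ha hb)), ?_⟩
  obtain ⟨F, hF, hFf, hF'⟩ := hf.exists_absolutelyContinuousOnInterval ha hb
  obtain ⟨G, hG, hGg, hG'⟩ := hg.exists_absolutelyContinuousOnInterval ha hb
  have key := hF.integral_deriv_mul_eq_sub hG
  rw [hFf left_mem_uIcc, hFf right_mem_uIcc, hGg left_mem_uIcc, hGg right_mem_uIcc] at key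
  rw [← key]
  refine intervalIntegral.integral_congr_ae ?_
  filter_upwards [hF', hG'] with t h1 h2 ht
  have ht' := uIoc_subset_uIcc ht
  rw [h1 ht', h2 ht', hFf ht', hGg ht']

theorem const_mul [J.OrdConnected] (c : ℝ) (hf : IsPrimitiveOn J f f') :
    IsPrimitiveOn J (fun t => c * f t) (fun t => c * f' t) :=
  ((const c).mul hf).congr_deriv fun t _ => by simp

theorem eq_of_deriv_eq_zero [J.OrdConnected] (hf : IsPrimitiveOn J f f')
    (h0 : ∀ t ∈ J, f' t = 0) {a b : ℝ} (ha : a ∈ J) (hb : b ∈ J) : f a = f b := by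
  have h := ((hf.congr_deriv h0) a ha b hb).2
  simp only [intervalIntegral.integral_zero] at h
  linarith

theorem integral {T : ℝ} (hT : T ∈ J)
    (hint : ∀ a ∈ J, ∀ b ∈ J, IntervalIntegrable f' volume a b) (c : ℝ) :
    IsPrimitiveOn J (fun t => c + ∫ s in T..t, f' s) f' := by
  intro a ha b hb
  refine ⟨hint a ha b hb, ?_⟩
  have := intervalIntegral.integral_add_adjacent_intervals (hint T hT a ha) (hint a ha b hb)
  simp only
  linarith

theorem dotProduct [J.OrdConnected] {ι : Type*} [Fintype ι] {x x' y y' : ℝ → ι → ℝ}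
    (hx : ∀ i, IsPrimitiveOn J (fun t => x t i) (fun t => x' t i))
    (hy : ∀ i, IsPrimitiveOn J (fun t => y t i) (fun t => y' t i)) :
    IsPrimitiveOn J (fun t => x t ⬝ᵥ y t) (fun t => x' t ⬝ᵥ y t + x t ⬝ᵥ y' t) := by
  simp only [_root_.dotProduct, ← Finset.sum_add_distrib]
  exact sum fun i _ => (hx i).mul (hy i)

end IsPrimitiveOn

/-- Every entry of `X` is a primitive of the corresponding entry of `X'` on `J`. -/
def IsMatrixPrimitiveOn {ι κ : Type*} (J : Set ℝ) (X X' : ℝ → Matrix ι κ ℝ) : Prop :=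
  ∀ i j, IsPrimitiveOn J (fun t => X t i j) (fun t => X' t i j)

namespace IsMatrixPrimitiveOn

variable {ι κ l : Type*} {J : Set ℝ} {X X' Z' : ℝ → Matrix ι κ ℝ} {Y Y' : ℝ → Matrix κ l ℝ}

theorem congr_deriv [J.OrdConnected] (h : IsMatrixPrimitiveOn J X X')
    (hX : ∀ t ∈ J, X' t = Z' t) : IsMatrixPrimitiveOn J X Z' :=
  fun i j => (h i j).congr_deriv fun t ht => by rw [hX t ht]

theorem transpose (h : IsMatrixPrimitiveOn J X X') :
    IsMatrixPrimitiveOn J (fun t => (X t)ᵀ) (fun t => (X' t)ᵀ) :=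
  fun i j => h j i

theorem sub [J.OrdConnected] {Z : ℝ → Matrix ι κ ℝ} (h : IsMatrixPrimitiveOn J X X')
    (hZ : IsMatrixPrimitiveOn J Z Z') :
    IsMatrixPrimitiveOn J (fun t => X t - Z t) (fun t => X' t - Z' t) := fun i j => by
  simpa [sub_eq_add_neg] using (h i j).add ((hZ i j).const_mul (-1))

theorem mul [J.OrdConnected] [Fintype κ] (hX : IsMatrixPrimitiveOn J X X')
    (hY : IsMatrixPrimitiveOn J Y Y') :
    IsMatrixPrimitiveOn J (fun t => X t * Y t) (fun t => X' t * Y t + X t * Y' t) := fun i j =>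
  IsPrimitiveOn.dotProduct (x := fun t => X t i) (x' := fun t => X' t i)
    (y := fun t k => Y t k j) (y' := fun t k => Y' t k j) (hX i) (fun k => hY k j)

theorem mulVec [J.OrdConnected] [Fintype κ] {x x' : ℝ → κ → ℝ} (hX : IsMatrixPrimitiveOn J X X')
    (hx : ∀ i, IsPrimitiveOn J (fun t => x t i) (fun t => x' t i)) (i : ι) :
    IsPrimitiveOn J (fun t => (X t *ᵥ x t) i) (fun t => (X' t *ᵥ x t + X t *ᵥ x' t) i) :=
  IsPrimitiveOn.dotProduct (x := fun t => X t i) (x' := fun t => X' t i) (hX i) hx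

theorem eq_of_deriv_eq_zero [J.OrdConnected] (h : IsMatrixPrimitiveOn J X X')
    (h0 : ∀ t ∈ J, X' t = 0) {a b : ℝ} (ha : a ∈ J) (hb : b ∈ J) : X a = X b :=
  Matrix.ext fun i j => (h i j).eq_of_deriv_eq_zero (fun t ht => by simp [h0 t ht]) ha hb

end IsMatrixPrimitiveOn

/-! ### Locally bounded measurable coefficients -/

/-- `f` is measurable and bounded on every compact subinterval of `J`: the regularity of the
coefficients under which linear equations are solvable. -/
def LocallyBoundedMeasurable (J : Set ℝ) (f : ℝ → ℝ) : Prop :=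
  ∀ a ∈ J, ∀ b ∈ J, AEStronglyMeasurable f (volume.restrict (Icc a b)) ∧
    ∃ M : ℝ, ∀ t ∈ Icc a b, |f t| ≤ M

namespace LocallyBoundedMeasurable

variable {J : Set ℝ} {f g f' : ℝ → ℝ}

theorem of_continuousOn (h : ∀ a ∈ J, ∀ b ∈ J, ContinuousOn f (Icc a b)) :
    LocallyBoundedMeasurable J f := fun a ha b hb =>
  ⟨(h a ha b hb).aestronglyMeasurable measurableSet_Icc,
    isCompact_Icc.exists_bound_of_continuousOn (h a ha b hb)⟩

theorem add (hf : LocallyBoundedMeasurable J f) (hg : LocallyBoundedMeasurable J g) :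
    LocallyBoundedMeasurable J (fun t => f t + g t) := by
  intro a ha b hb
  obtain ⟨h1, M, hM⟩ := hf a ha b hb
  obtain ⟨h2, N, hN⟩ := hg a ha b hb
  exact ⟨h1.add h2, M + N, fun t ht => (abs_add_le _ _).trans (add_le_add (hM t ht) (hN t ht))⟩

theorem mul (hf : LocallyBoundedMeasurable J f) (hg : LocallyBoundedMeasurable J g) :
    LocallyBoundedMeasurable J (fun t => f t * g t) := by
  intro a ha b hb
  obtain ⟨h1, M, hM⟩ := hf a ha b hb
  obtain ⟨h2, N, hN⟩ := hg a ha b hb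
  refine ⟨h1.mul h2, M * N, fun t ht => ?_⟩
  rw [abs_mul]
  exact mul_le_mul (hM t ht) (hN t ht) (abs_nonneg _) ((abs_nonneg _).trans (hM t ht))

theorem const (c : ℝ) : LocallyBoundedMeasurable J (fun _ => c) :=
  of_continuousOn fun _ _ _ _ => continuousOn_const

theorem sum {ι : Type*} {s : Finset ι} {F : ι → ℝ → ℝ}
    (h : ∀ i ∈ s, LocallyBoundedMeasurable J (F i)) :
    LocallyBoundedMeasurable J (fun t => ∑ i ∈ s, F i t) := by
  induction s using Finset.cons_induction with
  | empty => simpa using const 0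
  | cons i s hi ih =>
    simp only [Finset.sum_cons]
    exact (h i (Finset.mem_cons_self i s)).add
      (ih fun j hj => h j (Finset.mem_cons_of_mem hj))

theorem matrix_mul {ι κ l : Type*} [Fintype κ] {X : ℝ → Matrix ι κ ℝ} {Y : ℝ → Matrix κ l ℝ}
    (hX : ∀ i j, LocallyBoundedMeasurable J (fun t => X t i j))
    (hY : ∀ i j, LocallyBoundedMeasurable J (fun t => Y t i j)) (i : ι) (j : l) :
    LocallyBoundedMeasurable J (fun t => (X t * Y t) i j) :=
  sum fun k _ => (hX i k).mul (hY k j)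

theorem mulVec {ι κ : Type*} [Fintype κ] {X : ℝ → Matrix ι κ ℝ} {x : ℝ → κ → ℝ}
    (hX : ∀ i j, LocallyBoundedMeasurable J (fun t => X t i j))
    (hx : ∀ i, LocallyBoundedMeasurable J (fun t => x t i)) (i : ι) :
    LocallyBoundedMeasurable J (fun t => (X t *ᵥ x t) i) :=
  sum fun k _ => (hX i k).mul (hx k)

theorem dotProduct {ι : Type*} [Fintype ι] {x y : ℝ → ι → ℝ}
    (hx : ∀ i, LocallyBoundedMeasurable J (fun t => x t i))
    (hy : ∀ i, LocallyBoundedMeasurable J (fun t => y t i)) :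
    LocallyBoundedMeasurable J (fun t => x t ⬝ᵥ y t) :=
  sum fun k _ => (hx k).mul (hy k)

theorem mono {J' : Set ℝ} (h : LocallyBoundedMeasurable J f) (hJ : J' ⊆ J) :
    LocallyBoundedMeasurable J' f :=
  fun a ha b hb => h a (hJ ha) b (hJ hb)

theorem intervalIntegrable (h : LocallyBoundedMeasurable J f) {a b : ℝ} (ha : a ∈ J)
    (hb : b ∈ J) : IntervalIntegrable f volume a b := by
  wlog hab : a ≤ b generalizing a b
  · exact (this hb ha (le_of_not_ge hab)).symm
  obtain ⟨h1, M, hM⟩ := h a ha b hb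
  rw [intervalIntegrable_iff_integrableOn_Icc_of_le hab]
  refine Integrable.of_bound h1 M ?_
  filter_upwards [ae_restrict_mem measurableSet_Icc] with t ht using hM t ht

/-- Piecewise continuity gives measurability, because finite sets are null. -/
theorem of_piecewiseContinuous (h : PiecewiseContinuousLocallyBounded J f) :
    LocallyBoundedMeasurable J f := by
  intro a ha b hb
  obtain ⟨⟨F, hF, hc⟩, hM⟩ := h a ha b hb
  refine ⟨?_, hM⟩
  have hae : (Icc a b \ F : Set ℝ) =ᵐ[volume] Icc a b :=
    sdiff_null_ae_eq_self (hF.measure_zero volume)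
  rw [← Measure.restrict_congr_set hae]
  exact hc.aestronglyMeasurable (measurableSet_Icc.diff hF.measurableSet)

theorem of_isPrimitiveOn [J.OrdConnected] (h : IsPrimitiveOn J f f') :
    LocallyBoundedMeasurable J f := of_continuousOn fun _ ha _ hb =>
  (h.continuousOn_uIcc ha hb).mono Icc_subset_uIcc

end LocallyBoundedMeasurable

/-! ### Linear equations with locally bounded measurable coefficients -/

/-- The `k`-th term of the Peano–Baker (Picard) series for `dy/dt = M y`, `y T = c`. -/
noncomputable def peanoBakerTerm {ι : Type*} [Fintype ι] (M : ℝ → Matrix ι ι ℝ) (T : ℝ)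
    (c : ι → ℝ) : ℕ → ℝ → ι → ℝ
  | 0 => fun _ => c
  | k + 1 => fun t i => ∫ s in T..t, (M s *ᵥ peanoBakerTerm M T c k s) i

section PeanoBaker

variable {ι : Type*} [Fintype ι] {J : Set ℝ} {M : ℝ → Matrix ι ι ℝ} {T : ℝ}

theorem exists_peanoBakerTerm_deriv [J.OrdConnected]
    (hM : ∀ i j, LocallyBoundedMeasurable J (fun t => M t i j)) (hT : T ∈ J) (c : ι → ℝ) (k : ℕ) :
    ∀ i, ∃ f', IsPrimitiveOn J (fun t => peanoBakerTerm M T c k t i) f' := by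
  induction k with
  | zero => exact fun i => ⟨_, IsPrimitiveOn.const (c i)⟩
  | succ k ih =>
    intro i
    have hlb : ∀ i, LocallyBoundedMeasurable J (fun t => peanoBakerTerm M T c k t i) := fun i =>
      LocallyBoundedMeasurable.of_isPrimitiveOn (ih i).choose_spec
    refine ⟨fun s => (M s *ᵥ peanoBakerTerm M T c k s) i, ?_⟩
    have := IsPrimitiveOn.integral hT
      (fun a ha b hb => (LocallyBoundedMeasurable.mulVec hM hlb i).intervalIntegrable ha hb) 0
    simpa [peanoBakerTerm] using this

theorem locallyBoundedMeasurable_peanoBakerTerm [J.OrdConnected]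
    (hM : ∀ i j, LocallyBoundedMeasurable J (fun t => M t i j)) (hT : T ∈ J) (c : ι → ℝ) (k : ℕ)
    (i : ι) : LocallyBoundedMeasurable J (fun t => peanoBakerTerm M T c k t i) :=
  LocallyBoundedMeasurable.of_isPrimitiveOn (exists_peanoBakerTerm_deriv hM hT c k i).choose_spec

theorem abs_mulVec_le {A : Matrix ι ι ℝ} {x : ι → ℝ} {K b : ℝ} (hA : ∀ i j, |A i j| ≤ K)
    (hx : ∀ j, |x j| ≤ b) (i : ι) : |(A *ᵥ x) i| ≤ Fintype.card ι * K * b := by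
  calc |(A *ᵥ x) i| ≤ ∑ j, |A i j * x j| := Finset.abs_sum_le_sum_abs _ _
    _ ≤ ∑ _j : ι, K * b := Finset.sum_le_sum fun j _ => by
        rw [abs_mul]
        exact mul_le_mul (hA i j) (hx j) (abs_nonneg _) ((abs_nonneg _).trans (hA i j))
    _ = Fintype.card ι * K * b := by simp [mul_assoc]

theorem abs_peanoBakerTerm_le {a K b : ℝ} {c : ι → ℝ} (hK : ∀ t ∈ Icc a T, ∀ i j, |M t i j| ≤ K)
    (hc : ∀ i, |c i| ≤ b) (k : ℕ) {t : ℝ} (ht : t ∈ Icc a T) (i : ι) :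
    |peanoBakerTerm M T c k t i| ≤ b * ((Fintype.card ι * K * |t - T|) ^ k / k.factorial) := by
  induction k generalizing t i with
  | zero => simpa [peanoBakerTerm] using hc i
  | succ k ih =>
    have hsub : uIoc T t ⊆ Icc a T := by
      rw [uIoc_of_ge ht.2]
      exact fun s hs => ⟨ht.1.trans hs.1.le, hs.2⟩
    calc |peanoBakerTerm M T c (k + 1) t i|
        ≤ ∫ s in uIoc T t, ‖(M s *ᵥ peanoBakerTerm M T c k s) i‖ :=
          intervalIntegral.norm_integral_le_integral_norm_uIoc
            (f := fun s => (M s *ᵥ peanoBakerTerm M T c k s) i)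
      _ ≤ ∫ s in uIoc T t, Fintype.card ι * K *
            (b * ((Fintype.card ι * K) ^ k / k.factorial)) * |s - T| ^ k := by
          refine integral_mono_of_nonneg (Filter.Eventually.of_forall fun s => norm_nonneg _) ?_ ?_
          · have hcont : Continuous fun s : ℝ => Fintype.card ι * K *
                (b * ((Fintype.card ι * K) ^ k / k.factorial)) * |s - T| ^ k := by fun_prop
            exact (hcont.integrableOn_uIcc (a := T) (b := t)).mono_set uIoc_subset_uIcc
          · filter_upwards [ae_restrict_mem measurableSet_uIoc] with s hs
            rw [Real.norm_eq_abs]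
            refine (abs_mulVec_le (hK s (hsub hs)) (fun j => ih (hsub hs) j) i).trans_eq ?_
            rw [mul_pow]
            ring
      _ = b * ((Fintype.card ι * K * |t - T|) ^ (k + 1) / (k + 1).factorial) := by
          rw [integral_const_mul, integral_pow_abs_sub_uIoc, Nat.factorial_succ]
          push_cast
          field_simp
          ring

/-- Carathéodory existence for linear equations: the Peano–Baker series converges, uniformly on
compact subintervals, to a solution on all of `J`. -/
theorem exists_linear_solution [J.OrdConnected] (hT : IsGreatest J T)
    (hM : ∀ i j, LocallyBoundedMeasurable J (fun t => M t i j)) (c : ι → ℝ) :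
    ∃ y : ℝ → ι → ℝ, y T = c ∧ ∀ i, IsPrimitiveOn J (fun t => y t i) (fun t => (M t *ᵥ y t) i) := by
  classical
  have hTJ := hT.1
  obtain ⟨b, hb⟩ : ∃ b, ∀ i, |c i| ≤ b :=
    ⟨∑ i, |c i|, fun i =>
      Finset.single_le_sum (f := fun i => |c i|) (fun _ _ => abs_nonneg _) (Finset.mem_univ i)⟩
  have hbound : ∀ a ∈ J, ∃ K, ∀ t ∈ Icc a T, ∀ i j, |M t i j| ≤ K := by
    intro a ha
    choose K hK using fun i j => (hM i j a ha T hTJ).2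
    refine ⟨∑ i, ∑ j, |K i j|, fun t ht i j => (hK i j t ht).trans ((le_abs_self _).trans ?_)⟩
    refine (Finset.single_le_sum (f := fun j => |K i j|) (fun _ _ => abs_nonneg _)
      (Finset.mem_univ j)).trans ?_
    exact Finset.single_le_sum (f := fun i => ∑ j, |K i j|)
      (fun _ _ => Finset.sum_nonneg fun _ _ => abs_nonneg _) (Finset.mem_univ i)
  -- a summable majorant of the series on `[a, T]`, uniform in `t`
  have hmaj : ∀ a ∈ J, ∃ L : ℝ, ∀ k, ∀ t ∈ Icc a T, ∀ i,
      |peanoBakerTerm M T c k t i| ≤ |b| * (L ^ k / k.factorial) := by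
    intro a ha
    obtain ⟨K, hK⟩ := hbound a ha
    refine ⟨Fintype.card ι * |K| * (T - a), fun k t ht i => ?_⟩
    refine (abs_peanoBakerTerm_le (K := |K|) (b := |b|)
      (fun t ht i j => (hK t ht i j).trans (le_abs_self K))
      (fun i => (hb i).trans (le_abs_self b)) k ht i).trans ?_
    have h1 : |t - T| ≤ T - a := by
      rw [abs_sub_comm, abs_of_nonneg (by linarith [ht.2])]
      linarith [ht.1]
    gcongr
  have hsummaj : ∀ L : ℝ, Summable fun k : ℕ => |b| * (L ^ k / k.factorial) := fun L =>
    (Real.summable_pow_div_factorial L).mul_left _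
  set y : ℝ → ι → ℝ := fun t i => ∑' k, peanoBakerTerm M T c k t i with hy
  have hsum : ∀ t ∈ J, ∀ i, Summable fun k => peanoBakerTerm M T c k t i := by
    intro t ht i
    obtain ⟨L, hL⟩ := hmaj t ht
    exact Summable.of_norm_bounded (hsummaj L) fun k => hL k t ⟨le_rfl, hT.2 ht⟩ i
  have hylb : ∀ i, LocallyBoundedMeasurable J fun t => y t i := by
    intro i
    refine LocallyBoundedMeasurable.of_continuousOn fun a ha d hd => ?_
    have hsub : Icc a d ⊆ Icc a T := Icc_subset_Icc_right (hT.2 hd)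
    obtain ⟨L, hL⟩ := hmaj a ha
    refine continuousOn_tsum (fun k => ?_) (hsummaj L) fun k t ht => hL k t (hsub ht) i
    exact ((exists_peanoBakerTerm_deriv hM hTJ c k i).choose_spec.continuousOn_uIcc ha hd).mono
      Icc_subset_uIcc
  have hint : ∀ i, ∀ a ∈ J, ∀ d ∈ J,
      IntervalIntegrable (fun t => (M t *ᵥ y t) i) volume a d := fun i a ha d hd =>
    (LocallyBoundedMeasurable.mulVec hM hylb i).intervalIntegrable ha hd
  have hfix : ∀ t ∈ J, ∀ i, y t i = c i + ∫ s in T..t, (M s *ᵥ y s) i := by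
    intro t ht i
    obtain ⟨L, hL⟩ := hmaj t ht
    obtain ⟨K, hK⟩ := hbound t ht
    have hsub : uIoc T t ⊆ Icc t T := by
      rw [uIoc_of_ge (hT.2 ht)]
      exact Ioc_subset_Icc_self
    have hseries : HasSum (fun k => ∫ s in T..t, (M s *ᵥ peanoBakerTerm M T c k s) i)
        (∫ s in T..t, (M s *ᵥ y s) i) := by
      refine intervalIntegral.hasSum_integral_of_dominated_convergence
        (fun k _ => Fintype.card ι * K * (|b| * (L ^ k / k.factorial))) (fun k => ?_)
        (fun k => ?_) ?_ ?_ ?_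
      · exact ((LocallyBoundedMeasurable.mulVec hM
          (locallyBoundedMeasurable_peanoBakerTerm hM hTJ c k) i t ht T hTJ).1).mono_measure
          (Measure.restrict_mono hsub le_rfl)
      · exact Filter.Eventually.of_forall fun s hs =>
          abs_mulVec_le (hK s (hsub hs)) (fun j => hL k s (hsub hs) j) i
      · exact Filter.Eventually.of_forall fun s hs => (hsummaj L).mul_left _
      · exact intervalIntegrable_const
      · refine Filter.Eventually.of_forall fun s hs => ?_
        have hsJ : s ∈ J := OrdConnected.out ‹_› ht hTJ (hsub hs)
        exact hasSum_sum fun j _ => ((hsum s hsJ j).hasSum).mul_left (M s i j)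
    calc y t i = peanoBakerTerm M T c 0 t i + ∑' k, peanoBakerTerm M T c (k + 1) t i :=
          (hsum t ht i).tsum_eq_zero_add
      _ = c i + ∫ s in T..t, (M s *ᵥ y s) i := by
          rw [← hseries.tsum_eq]
          rfl
  refine ⟨y, ?_, fun i a ha d hd => ?_⟩
  · ext i
    simpa using hfix T hTJ i
  · have := IsPrimitiveOn.integral hTJ (hint i) (c i) a ha d hd
    simp only [← hfix a ha i, ← hfix d hd i] at this
    exact this

theorem exists_matrix_linear_solution {κ : Type*} [J.OrdConnected] (hT : IsGreatest J T)
    (hM : ∀ i j, LocallyBoundedMeasurable J (fun t => M t i j)) (Y₀ : Matrix ι κ ℝ) :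
    ∃ Y : ℝ → Matrix ι κ ℝ, Y T = Y₀ ∧ IsMatrixPrimitiveOn J Y (fun t => M t * Y t) := by
  choose y hy hy' using fun j => exists_linear_solution hT hM (fun i => Y₀ i j)
  exact ⟨fun t => Matrix.of fun i j => y j t i,
    Matrix.ext fun i j => congrFun (hy j) i, fun i j => hy' j i⟩

end PeanoBaker

/-! ### The dual fundamental matrix and symmetry of Riccati solutions -/

section FundamentalMatrix

variable {n m : ℕ} {J : Set ℝ} {T : ℝ} [J.OrdConnected]

/-- If `dS/dt = -B'S` with `S T` invertible, then `S'` is inverted by the solution `R` of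
`dR/dt = BR` with the matching terminal value, since `S'R` has zero derivative. -/
theorem exists_dual_fundamental_matrix (hT : IsGreatest J T)
    {B S : ℝ → Matrix (Fin n) (Fin n) ℝ}
    (hB : ∀ i j, LocallyBoundedMeasurable J (fun t => B t i j))
    (hS : IsMatrixPrimitiveOn J S (fun t => -((B t)ᵀ * S t))) (hST : IsUnit (S T)) :
    ∃ R : ℝ → Matrix (Fin n) (Fin n) ℝ, IsMatrixPrimitiveOn J R (fun t => B t * R t) ∧
      ∀ t ∈ J, (S t)ᵀ * R t = 1 := by
  obtain ⟨R, hRT, hR⟩ := exists_matrix_linear_solution hT hB ((S T)ᵀ)⁻¹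
  refine ⟨R, hR, fun t ht => ?_⟩
  have hprod := hS.transpose.mul hR
  rw [hprod.eq_of_deriv_eq_zero (fun s _ => ?_) ht hT.1, hRT]
  · refine Matrix.mul_nonsing_inv _ ?_
    rw [Matrix.det_transpose]
    exact (Matrix.isUnit_iff_isUnit_det _).1 hST
  · simp [Matrix.transpose_mul, Matrix.mul_assoc]

theorem exists_backward_linear_solution (hT : IsGreatest J T)
    {B : ℝ → Matrix (Fin n) (Fin n) ℝ}
    (hB : ∀ i j, LocallyBoundedMeasurable J (fun t => B t i j))
    (S₀ : Matrix (Fin n) (Fin n) ℝ) :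
    ∃ S : ℝ → Matrix (Fin n) (Fin n) ℝ, S T = S₀ ∧
      IsMatrixPrimitiveOn J S (fun t => -((B t)ᵀ * S t)) := by
  have hM : ∀ i j, LocallyBoundedMeasurable J (fun t => (-(B t)ᵀ) i j) := fun i j => by
    simpa using (LocallyBoundedMeasurable.const (-1)).mul (hB j i)
  obtain ⟨S, hST, hS⟩ := exists_matrix_linear_solution hT hM S₀
  exact ⟨S, hST, hS.congr_deriv fun t _ => by rw [Matrix.neg_mul]⟩

/-- The difference `D = P - P'` solves the linear Lyapunov equation `-dD/dt = B'D + DB` with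
`B = A + ΣP'` and zero terminal value, hence vanishes. -/
theorem IsRiccatiSolution.isSymm (hT : IsGreatest J T)
    {A C P : ℝ → Matrix (Fin n) (Fin n) ℝ} {σ : ℝ → Matrix (Fin n) (Fin m) ℝ}
    (hA : ∀ i j, LocallyBoundedMeasurable J (fun t => A t i j))
    (hσ : ∀ i j, LocallyBoundedMeasurable J (fun t => σ t i j))
    (hC : ∀ t ∈ J, (C t).IsSymm) (hP : IsRiccatiSolution J A C σ P) (hPT : (P T).IsSymm)
    {t : ℝ} (ht : t ∈ J) : (P t).IsSymm := by
  have hP' : IsMatrixPrimitiveOn J P (fun t => -((A t)ᵀ * P t + P t * A t + C t +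
    P t * (σ t * (σ t)ᵀ) * P t)) := hP
  have hPlb : ∀ i j, LocallyBoundedMeasurable J (fun t => P t i j) := fun i j =>
    LocallyBoundedMeasurable.of_isPrimitiveOn (hP i j)
  set B : ℝ → Matrix (Fin n) (Fin n) ℝ := fun t => A t + σ t * (σ t)ᵀ * (P t)ᵀ with hBdef
  have hB : ∀ i j, LocallyBoundedMeasurable J (fun t => B t i j) := fun i j =>
    (hA i j).add (LocallyBoundedMeasurable.matrix_mul
      (LocallyBoundedMeasurable.matrix_mul hσ (fun i j => hσ j i)) (fun i j => hPlb j i) i j)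
  obtain ⟨S, hST, hS⟩ := exists_backward_linear_solution hT hB 1
  obtain ⟨R, hR, hSR⟩ := exists_dual_fundamental_matrix hT hB hS (by rw [hST]; exact isUnit_one)
  -- `R'(P - P')R` has zero derivative and vanishes at `T`
  have hconst := (hR.transpose.mul (hP'.sub hP'.transpose)).mul hR
  have hzero : (R t)ᵀ * (P t - (P t)ᵀ) * R t = 0 := by
    rw [hconst.eq_of_deriv_eq_zero (fun s hs => ?_) ht hT.1, hPT.eq]
    · simp
    · simp only [hBdef, Matrix.transpose_mul, Matrix.transpose_add, Matrix.transpose_neg,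
        Matrix.transpose_transpose, (hC s hs).eq]
      noncomm_ring
  have hRS : R t * (S t)ᵀ = 1 := mul_eq_one_comm.1 (hSR t ht)
  have hSR' : S t * (R t)ᵀ = 1 := by
    rw [← Matrix.transpose_one, ← hRS, Matrix.transpose_mul, Matrix.transpose_transpose]
  have hD : P t - (P t)ᵀ = 0 := by
    calc P t - (P t)ᵀ = (S t * (R t)ᵀ) * (P t - (P t)ᵀ) * (R t * (S t)ᵀ) := by
          rw [hSR', hRS, one_mul, mul_one]
      _ = S t * ((R t)ᵀ * (P t - (P t)ᵀ) * R t) * (S t)ᵀ := by noncomm_ring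
      _ = 0 := by rw [hzero]; simp
  exact (sub_eq_zero.1 hD).symm

end FundamentalMatrix

/-! ### Completion of squares -/

section CompletionOfSquares

variable {n m : ℕ} {A C P S Q : ℝ → Matrix (Fin n) (Fin n) ℝ}
  {σ : ℝ → Matrix (Fin n) (Fin m) ℝ} {t₁ t₂ : ℝ} {u : ℝ → Fin m → ℝ} {ξ : ℝ → Fin n → ℝ}

theorem IsBivariateRiccatiSolution.mono {J J' : Set ℝ}
    (h : IsBivariateRiccatiSolution J A C σ P S Q) (hJ : J' ⊆ J) :
    IsBivariateRiccatiSolution J' A C σ P S Q where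
  riccati i j := (h.riccati i j).mono hJ
  linear i j := (h.linear i j).mono hJ
  quadrature i j := (h.quadrature i j).mono hJ

/-- The optimal feedback `σ'(Pξ + Sz)`. -/
def optimalFeedback (P S : Matrix (Fin n) (Fin n) ℝ) (σ : Matrix (Fin n) (Fin m) ℝ)
    (z x : Fin n → ℝ) : Fin m → ℝ :=
  σᵀ *ᵥ (P *ᵥ x + S *ᵥ z)

theorem intervalIntegrable_runningPayoff (h12 : t₁ ≤ t₂)
    (hC : ∀ i j, LocallyBoundedMeasurable (Icc t₁ t₂) (fun t => C t i j))
    (h : IsControlledTrajectory A σ t₁ t₂ u ξ) :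
    IntervalIntegrable
      (fun t => (1 / 2) * (ξ t ⬝ᵥ (C t *ᵥ ξ t)) - (1 / 2) * (u t ⬝ᵥ u t)) volume t₁ t₂ := by
  have hξ : ∀ i, LocallyBoundedMeasurable (Icc t₁ t₂) (fun t => ξ t i) := fun i =>
    LocallyBoundedMeasurable.of_isPrimitiveOn (h.dynamics i)
  have hu : IntervalIntegrable (fun t => u t ⬝ᵥ u t) volume t₁ t₂ := by
    rw [intervalIntegrable_iff_integrableOn_Icc_of_le h12]
    refine integrable_finsetSum _ fun i _ => ?_
    simpa [sq] using (h.control_mem.eval i).integrable_sq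
  exact (((LocallyBoundedMeasurable.dotProduct hξ
    (LocallyBoundedMeasurable.mulVec hC hξ)).intervalIntegrable (left_mem_Icc.2 h12)
      (right_mem_Icc.2 h12)).const_mul _).sub (hu.const_mul _)

/-- The pointwise identity behind completion of squares: the derivative of
`½ ξ'Pξ + ξ'Sz + ½ z'Qz` along a trajectory is minus the running payoff minus half the squared
distance of the control to the optimal feedback. -/
theorem bivariateQuadratic_deriv_eq {A C P S : Matrix (Fin n) (Fin n) ℝ}
    {σ : Matrix (Fin n) (Fin m) ℝ} (hP : P.IsSymm) (u : Fin m → ℝ) (x z : Fin n → ℝ) :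
    (1 / 2) * ((A *ᵥ x + σ *ᵥ u) ⬝ᵥ (P *ᵥ x) +
        x ⬝ᵥ ((-(Aᵀ * P + P * A + C + P * (σ * σᵀ) * P)) *ᵥ x + P *ᵥ (A *ᵥ x + σ *ᵥ u))) +
      ((A *ᵥ x + σ *ᵥ u) ⬝ᵥ (S *ᵥ z) + x ⬝ᵥ ((-((A + σ * σᵀ * P)ᵀ * S)) *ᵥ z)) +
      (1 / 2) * (z ⬝ᵥ ((-(Sᵀ * (σ * σᵀ) * S)) *ᵥ z)) =
    -((1 / 2) * (x ⬝ᵥ (C *ᵥ x)) - (1 / 2) * (u ⬝ᵥ u)) -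
      (1 / 2) * ((u - optimalFeedback P S σ z x) ⬝ᵥ (u - optimalFeedback P S σ z x)) := by
  have htr : ∀ {k l : ℕ} (M : Matrix (Fin k) (Fin l) ℝ) (a : Fin l → ℝ) (b : Fin k → ℝ),
      a ⬝ᵥ (Mᵀ *ᵥ b) = (M *ᵥ a) ⬝ᵥ b := fun M a b => by
    rw [Matrix.dotProduct_mulVec, Matrix.vecMul_transpose]
  have hPx : ∀ b : Fin n → ℝ, x ⬝ᵥ (P *ᵥ b) = (P *ᵥ x) ⬝ᵥ b := fun b => by
    conv_lhs => rw [← hP.eq]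
    exact htr P x b
  have hσs : ∀ (a : Fin n → ℝ) (b : Fin m → ℝ), a ⬝ᵥ (σ *ᵥ b) = (σᵀ *ᵥ a) ⬝ᵥ b := fun a b => by
    conv_lhs => rw [← Matrix.transpose_transpose σ]
    exact htr _ a b
  simp only [optimalFeedback, Matrix.transpose_add, Matrix.transpose_mul,
    Matrix.transpose_transpose, hP.eq, Matrix.neg_mulVec, Matrix.add_mulVec, Matrix.mulVec_add,
    ← Matrix.mulVec_mulVec, dotProduct_add, add_dotProduct, dotProduct_sub, sub_dotProduct,
    dotProduct_neg, htr A, htr S, hPx, hσs, ← htr σ, Matrix.add_mul]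
  rw [dotProduct_comm (A *ᵥ x) (P *ᵥ x), dotProduct_comm u (σᵀ *ᵥ (P *ᵥ x)),
    dotProduct_comm u (σᵀ *ᵥ (S *ᵥ z)), dotProduct_comm (σᵀ *ᵥ (S *ᵥ z)) (σᵀ *ᵥ (P *ᵥ x))]
  ring

/-- Completion of squares: along any trajectory the running payoff differs from the drop of the
bivariate quadratic by half the squared `L²` distance of the control to the optimal feedback. -/
theorem runningPayoff_add_bivariateQuadratic (h12 : t₁ ≤ t₂)
    (hC : ∀ i j, LocallyBoundedMeasurable (Icc t₁ t₂) (fun t => C t i j))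
    (hsol : IsBivariateRiccatiSolution (Icc t₁ t₂) A C σ P S Q)
    (hP : ∀ t ∈ Icc t₁ t₂, (P t).IsSymm) (h : IsControlledTrajectory A σ t₁ t₂ u ξ)
    (z : Fin n → ℝ) :
    runningPayoff C t₁ t₂ u ξ + bivariateQuadratic (P t₂) (S t₂) (Q t₂) (ξ t₂) z =
      bivariateQuadratic (P t₁) (S t₁) (Q t₁) (ξ t₁) z -
        (1 / 2) * ∫ t in t₁..t₂, (u t - optimalFeedback (P t) (S t) (σ t) z (ξ t)) ⬝ᵥ
          (u t - optimalFeedback (P t) (S t) (σ t) z (ξ t)) := by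
  have hPd : IsMatrixPrimitiveOn (Icc t₁ t₂) P _ := hsol.riccati
  have hSd : IsMatrixPrimitiveOn (Icc t₁ t₂) S _ := hsol.linear
  have hQd : IsMatrixPrimitiveOn (Icc t₁ t₂) Q _ := hsol.quadrature
  have hz : ∀ i, IsPrimitiveOn (Icc t₁ t₂) (fun _ => z i) (fun _ => (0 : Fin n → ℝ) i) :=
    fun i => IsPrimitiveOn.const (z i)
  have hW := (((IsPrimitiveOn.dotProduct h.dynamics (hPd.mulVec h.dynamics)).const_mul (1 / 2)).add
    (IsPrimitiveOn.dotProduct h.dynamics (hSd.mulVec hz))).add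
    ((IsPrimitiveOn.dotProduct hz (hQd.mulVec hz)).const_mul (1 / 2))
  have hW' := hW.congr_deriv
    (g' := fun t => -((1 / 2) * (ξ t ⬝ᵥ (C t *ᵥ ξ t)) - (1 / 2) * (u t ⬝ᵥ u t)) -
      (1 / 2) * ((u t - optimalFeedback (P t) (S t) (σ t) z (ξ t)) ⬝ᵥ
        (u t - optimalFeedback (P t) (S t) (σ t) z (ξ t)))) fun t ht => by
    rw [← bivariateQuadratic_deriv_eq (hP t ht)]
    simp only [Matrix.mulVec_zero, add_zero, zero_dotProduct, zero_add]
    rfl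
  obtain ⟨hint, heq⟩ := hW' t₁ (left_mem_Icc.2 h12) t₂ (right_mem_Icc.2 h12)
  have hpay := intervalIntegrable_runningPayoff h12 hC h
  have hsum := intervalIntegral.integral_add hint hpay
  rw [← heq] at hsum
  have hsimp : ∀ t, (-((1 / 2) * (ξ t ⬝ᵥ (C t *ᵥ ξ t)) - (1 / 2) * (u t ⬝ᵥ u t)) -
      (1 / 2) * ((u t - optimalFeedback (P t) (S t) (σ t) z (ξ t)) ⬝ᵥ
        (u t - optimalFeedback (P t) (S t) (σ t) z (ξ t)))) +
      ((1 / 2) * (ξ t ⬝ᵥ (C t *ᵥ ξ t)) - (1 / 2) * (u t ⬝ᵥ u t)) =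
      (-(1 / 2)) * ((u t - optimalFeedback (P t) (S t) (σ t) z (ξ t)) ⬝ᵥ
        (u t - optimalFeedback (P t) (S t) (σ t) z (ξ t))) := fun t => by ring
  simp only [hsimp, intervalIntegral.integral_const_mul] at hsum
  simp only [runningPayoff, bivariateQuadratic]
  linarith

end CompletionOfSquares

/-! ### Coefficients and solutions on the time interval -/

section TimeInterval

variable {n m : ℕ} {Tbar : EReal} {T : ℝ} {A C P S Q : ℝ → Matrix (Fin n) (Fin n) ℝ}
  {σ : ℝ → Matrix (Fin n) (Fin m) ℝ} {PT ST QT : Matrix (Fin n) (Fin n) ℝ} {t₁ t₂ : ℝ}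

instance ordConnected_timeInterval : (timeInterval Tbar T).OrdConnected :=
  ⟨fun _ ha _ hb _ ht => ⟨ha.1.trans_le (EReal.coe_le_coe_iff.2 ht.1), ht.2.trans hb.2⟩⟩

theorem isGreatest_timeInterval {t : ℝ} (ht : t ∈ timeInterval Tbar T) :
    IsGreatest (timeInterval Tbar T) T :=
  ⟨⟨ht.1.trans_le (EReal.coe_le_coe_iff.2 ht.2), le_rfl⟩, fun _ hs => hs.2⟩

theorem Icc_subset_timeInterval (h₁ : t₁ ∈ timeInterval Tbar T) (h₂ : t₂ ∈ timeInterval Tbar T) :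
    Icc t₁ t₂ ⊆ timeInterval Tbar T :=
  OrdConnected.out inferInstance h₁ h₂

namespace StandingAssumptions

theorem locallyBoundedMeasurable_A (hA : StandingAssumptions Tbar T A C σ PT) (i j : Fin n) :
    LocallyBoundedMeasurable (timeInterval Tbar T) (fun t => A t i j) :=
  .of_piecewiseContinuous (hA.regular_A i j)

theorem locallyBoundedMeasurable_C (hA : StandingAssumptions Tbar T A C σ PT) (i j : Fin n) :
    LocallyBoundedMeasurable (timeInterval Tbar T) (fun t => C t i j) :=
  .of_piecewiseContinuous (hA.regular_C i j)

/-- The diagonal of `σσ'` dominates the squared entries of `σ`. -/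
theorem locallyBoundedMeasurable_sigma (hA : StandingAssumptions Tbar T A C σ PT) (i : Fin n)
    (j : Fin m) : LocallyBoundedMeasurable (timeInterval Tbar T) (fun t => σ t i j) := by
  intro a ha b hb
  refine ⟨((hA.measurable_sigma i j).mono_measure (Measure.restrict_mono
    (Icc_subset_timeInterval ha hb) le_rfl)).aestronglyMeasurable, ?_⟩
  obtain ⟨M, hM⟩ := (hA.regular_Sigma i i a ha b hb).2
  refine ⟨√M, fun t ht => Real.abs_le_sqrt (le_trans ?_ ((le_abs_self _).trans (hM t ht)))⟩
  simp only [Matrix.mul_apply, Matrix.transpose_apply, ← sq]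
  exact Finset.single_le_sum (f := fun k => σ t i k ^ 2) (fun _ _ => sq_nonneg _)
    (Finset.mem_univ j)

theorem locallyBoundedMeasurable_closedLoop (hA : StandingAssumptions Tbar T A C σ PT)
    (hP : IsRiccatiSolution (timeInterval Tbar T) A C σ P) (i j : Fin n) :
    LocallyBoundedMeasurable (timeInterval Tbar T)
      (fun t => (A t + σ t * (σ t)ᵀ * P t) i j) :=
  (hA.locallyBoundedMeasurable_A i j).add (LocallyBoundedMeasurable.matrix_mul
    (LocallyBoundedMeasurable.matrix_mul hA.locallyBoundedMeasurable_sigma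
      (fun i j => hA.locallyBoundedMeasurable_sigma j i))
    (fun i j => LocallyBoundedMeasurable.of_isPrimitiveOn (hP i j)) i j)

/-- Given `P`, the equation for `S` is linear and the one for `Q` is a quadrature. -/
theorem exists_isBivariateRiccatiSolution (hA : StandingAssumptions Tbar T A C σ PT)
    (ST QT : Matrix (Fin n) (Fin n) ℝ) :
    ∃ P S Q : ℝ → Matrix (Fin n) (Fin n) ℝ,
      IsBivariateRiccatiSolution (timeInterval Tbar T) A C σ P S Q ∧
        P T = PT ∧ S T = ST ∧ Q T = QT := by
  obtain ⟨P, hP, hPT⟩ := hA.riccati_exists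
  rcases (timeInterval Tbar T).eq_empty_or_nonempty with hJ | ⟨t, ht⟩
  -- on an empty time interval the equations are void
  · refine ⟨P, fun _ => ST, fun _ => QT, ⟨hP, fun i j => ?_, fun i j => ?_⟩, hPT, rfl, rfl⟩ <;>
      · intro a ha
        simp [hJ] at ha
  have hT := isGreatest_timeInterval ht
  obtain ⟨S, hST, hS⟩ := exists_backward_linear_solution hT
    (hA.locallyBoundedMeasurable_closedLoop hP) ST
  have hSlb : ∀ i j, LocallyBoundedMeasurable (timeInterval Tbar T) (fun t => S t i j) :=
    fun i j => LocallyBoundedMeasurable.of_isPrimitiveOn (hS i j)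
  have hG : ∀ i j, LocallyBoundedMeasurable (timeInterval Tbar T)
      (fun t => ((S t)ᵀ * (σ t * (σ t)ᵀ) * S t) i j) := fun i j =>
    LocallyBoundedMeasurable.matrix_mul (LocallyBoundedMeasurable.matrix_mul
      (fun i j => hSlb j i) (LocallyBoundedMeasurable.matrix_mul hA.locallyBoundedMeasurable_sigma
        (fun i j => hA.locallyBoundedMeasurable_sigma j i))) hSlb i j
  refine ⟨P, S, fun t => Matrix.of fun i j =>
    QT i j + ∫ s in T..t, -((S s)ᵀ * (σ s * (σ s)ᵀ) * S s) i j, ⟨hP, hS, fun i j => ?_⟩, hPT, hST,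
    Matrix.ext fun i j => by simp⟩
  exact IsPrimitiveOn.integral hT.1 (fun a ha b hb => ((hG i j).intervalIntegrable ha hb).neg) _

end StandingAssumptions

namespace IsBivariateRiccatiSolution

theorem isSymm (hsol : IsBivariateRiccatiSolution (timeInterval Tbar T) A C σ P S Q)
    (hA : StandingAssumptions Tbar T A C σ PT) (hPT : (P T).IsSymm) {t : ℝ}
    (ht : t ∈ timeInterval Tbar T) : (P t).IsSymm :=
  hsol.riccati.isSymm (isGreatest_timeInterval ht) hA.locallyBoundedMeasurable_A
    hA.locallyBoundedMeasurable_sigma hA.symm_C hPT ht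

theorem isUnit_S (hsol : IsBivariateRiccatiSolution (timeInterval Tbar T) A C σ P S Q)
    (hA : StandingAssumptions Tbar T A C σ PT) (hST : IsUnit (S T)) {t : ℝ}
    (ht : t ∈ timeInterval Tbar T) : IsUnit (S t) := by
  obtain ⟨R, -, hR⟩ := exists_dual_fundamental_matrix (isGreatest_timeInterval ht)
    (hA.locallyBoundedMeasurable_closedLoop hsol.riccati) hsol.linear hST
  rw [← Matrix.isUnit_transpose]
  exact IsUnit.of_mul_eq_one _ (hR t ht)

/-- `Q - Q'` is constant, because `dQ/dt` is symmetric. -/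
theorem isSymm_Q_sub (hsol : IsBivariateRiccatiSolution (timeInterval Tbar T) A C σ P S Q)
    (h₁ : t₁ ∈ timeInterval Tbar T) (h₂ : t₂ ∈ timeInterval Tbar T) :
    (Q t₁ - Q t₂).IsSymm := by
  have hQ : IsMatrixPrimitiveOn (timeInterval Tbar T) Q _ := hsol.quadrature
  have h := (hQ.sub hQ.transpose).eq_of_deriv_eq_zero (fun t _ => ?_) h₁ h₂
  · rw [Matrix.IsSymm, Matrix.transpose_sub]
    have h' : Q t₁ - (Q t₁)ᵀ = Q t₂ - (Q t₂)ᵀ := h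
    rw [sub_eq_sub_iff_add_eq_add] at h' ⊢
    rw [add_comm, ← h', add_comm]
  · change -((S t)ᵀ * (σ t * (σ t)ᵀ) * S t) - (-((S t)ᵀ * (σ t * (σ t)ᵀ) * S t))ᵀ = 0
    simp [Matrix.transpose_mul, Matrix.mul_assoc]

/-! ### Weak duality and its attainment -/

/-- Weak duality: the squared distance to the optimal feedback is nonnegative. -/
theorem runningPayoff_le (hsol : IsBivariateRiccatiSolution (timeInterval Tbar T) A C σ P S Q)
    (hA : StandingAssumptions Tbar T A C σ PT) (hPT : (P T).IsSymm)
    (h₁ : t₁ ∈ timeInterval Tbar T) (h₂ : t₂ ∈ timeInterval Tbar T) (h12 : t₁ ≤ t₂)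
    {u : ℝ → Fin m → ℝ} {ξ : ℝ → Fin n → ℝ} (h : IsControlledTrajectory A σ t₁ t₂ u ξ)
    (z : Fin n → ℝ) :
    runningPayoff C t₁ t₂ u ξ ≤ bivariateQuadratic (P t₁) (S t₁) (Q t₁) (ξ t₁) z -
      bivariateQuadratic (P t₂) (S t₂) (Q t₂) (ξ t₂) z := by
  have hsub := Icc_subset_timeInterval h₁ h₂
  have hid := runningPayoff_add_bivariateQuadratic h12
    (fun i j => (hA.locallyBoundedMeasurable_C i j).mono hsub) (hsol.mono hsub)
    (fun t ht => hsol.isSymm hA hPT (hsub ht)) h z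
  have hnn : 0 ≤ ∫ t in t₁..t₂, (u t - optimalFeedback (P t) (S t) (σ t) z (ξ t)) ⬝ᵥ
      (u t - optimalFeedback (P t) (S t) (σ t) z (ξ t)) :=
    intervalIntegral.integral_nonneg h12 fun t _ =>
      Finset.sum_nonneg fun i _ => mul_self_nonneg _
  linarith

/-- The closed loop under the optimal feedback. Along it `S'ξ + Qz` is constant, so the trajectory
is explicit in terms of the inverse `R` of `S'`, and its endpoint is determined by the linear
equation `S₂'y = S₁'x + (Q₁ - Q₂)z`. -/
theorem exists_optimal_trajectory
    (hsol : IsBivariateRiccatiSolution (timeInterval Tbar T) A C σ P S Q)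
    (hA : StandingAssumptions Tbar T A C σ PT) (hPT : (P T).IsSymm) (hST : IsUnit (S T))
    (h₁ : t₁ ∈ timeInterval Tbar T) (h₂ : t₂ ∈ timeInterval Tbar T) (h12 : t₁ ≤ t₂)
    (x z : Fin n → ℝ) :
    ∃ (u : ℝ → Fin m → ℝ) (ξ : ℝ → Fin n → ℝ),
      IsControlledTrajectory A σ t₁ t₂ u ξ ∧ ξ t₁ = x ∧
      (∀ y, (S t₂)ᵀ *ᵥ y = (S t₁)ᵀ *ᵥ x + (Q t₁ - Q t₂) *ᵥ z → ξ t₂ = y) ∧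
      runningPayoff C t₁ t₂ u ξ = bivariateQuadratic (P t₁) (S t₁) (Q t₁) (ξ t₁) z -
        bivariateQuadratic (P t₂) (S t₂) (Q t₂) (ξ t₂) z := by
  have hsub := Icc_subset_timeInterval h₁ h₂
  obtain ⟨R, hR, hSR⟩ := exists_dual_fundamental_matrix (isGreatest_timeInterval h₁)
    (hA.locallyBoundedMeasurable_closedLoop hsol.riccati) hsol.linear hST
  have hRS : ∀ t ∈ timeInterval Tbar T, R t * (S t)ᵀ = 1 := fun t ht =>
    mul_eq_one_comm.1 (hSR t ht)
  -- the solution of `S'ξ + Qz = const` with `ξ t₁ = x`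
  set ξ : ℝ → Fin n → ℝ := fun t => R t *ᵥ (((S t₁)ᵀ *ᵥ x + Q t₁ *ᵥ z) - Q t *ᵥ z) with hξ
  set u : ℝ → Fin m → ℝ := fun t => optimalFeedback (P t) (S t) (σ t) z (ξ t) with hu
  have hQ : IsMatrixPrimitiveOn (timeInterval Tbar T) Q
      (fun t => -((S t)ᵀ * (σ t * (σ t)ᵀ) * S t)) := hsol.quadrature
  have hconst : ∀ v : Fin n → ℝ, ∀ i,
      IsPrimitiveOn (timeInterval Tbar T) (fun _ => v i) (fun _ => (0 : Fin n → ℝ) i) :=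
    fun v i => IsPrimitiveOn.const (v i)
  have hw : ∀ i, IsPrimitiveOn (timeInterval Tbar T)
      (fun t => (((S t₁)ᵀ *ᵥ x + Q t₁ *ᵥ z) - Q t *ᵥ z) i)
      (fun t => (((S t)ᵀ * (σ t * (σ t)ᵀ) * S t) *ᵥ z) i) := by
    intro i
    have h := (hconst ((S t₁)ᵀ *ᵥ x + Q t₁ *ᵥ z) i).add
      (((hQ.mulVec (hconst z)) i).const_mul (-1))
    simpa [sub_eq_add_neg, Matrix.neg_mulVec] using h
  have hdyn : ∀ i, IsPrimitiveOn (timeInterval Tbar T) (fun t => ξ t i)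
      (fun t => (A t *ᵥ ξ t + σ t *ᵥ u t) i) := by
    intro i
    refine (hR.mulVec hw i).congr_deriv fun t ht => congrFun ?_ i
    have hz : R t *ᵥ (((S t)ᵀ * (σ t * (σ t)ᵀ) * S t) *ᵥ z) =
        σ t *ᵥ ((σ t)ᵀ *ᵥ (S t *ᵥ z)) := by
      simp only [Matrix.mulVec_mulVec, ← Matrix.mul_assoc, hRS t ht, Matrix.one_mul]
    rw [hz]
    simp only [hu, hξ, optimalFeedback, Matrix.mulVec_add, Matrix.add_mulVec, Matrix.add_mul,
      Matrix.mulVec_sub, ← Matrix.mulVec_mulVec]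
    abel
  have hlb : ∀ {f g : ℝ → ℝ}, IsPrimitiveOn (timeInterval Tbar T) f g →
      LocallyBoundedMeasurable (timeInterval Tbar T) f :=
    fun h => LocallyBoundedMeasurable.of_isPrimitiveOn h
  have hulb : ∀ i, LocallyBoundedMeasurable (timeInterval Tbar T) (fun t => u t i) :=
    LocallyBoundedMeasurable.mulVec (fun i j => hA.locallyBoundedMeasurable_sigma j i)
      fun i => (LocallyBoundedMeasurable.mulVec (fun i j => hlb (hsol.riccati i j))
        (fun i => hlb (hdyn i)) i).add (LocallyBoundedMeasurable.mulVec
          (fun i j => hlb (hsol.linear i j)) (fun i => .const (z i)) i)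
  have htraj : IsControlledTrajectory A σ t₁ t₂ u ξ := by
    refine ⟨memLp_pi_iff.2 fun i => ?_, fun i => (hdyn i).mono hsub⟩
    obtain ⟨hmeas, M, hM⟩ := hulb i t₁ h₁ t₂ h₂
    refine MemLp.of_bound hmeas M ?_
    filter_upwards [ae_restrict_mem measurableSet_Icc] with t ht using hM t ht
  refine ⟨u, ξ, htraj, ?_, fun y hy => ?_, ?_⟩
  · simp [hξ, Matrix.mulVec_mulVec, hRS t₁ h₁]
  · have : (S t₁)ᵀ *ᵥ x + Q t₁ *ᵥ z - Q t₂ *ᵥ z = (S t₂)ᵀ *ᵥ y := by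
      rw [hy, Matrix.sub_mulVec]
      abel
    simp only [hξ, this, Matrix.mulVec_mulVec, hRS t₂ h₂, Matrix.one_mulVec]
  · have hid := runningPayoff_add_bivariateQuadratic h12
      (fun i j => (hA.locallyBoundedMeasurable_C i j).mono hsub) (hsol.mono hsub)
      (fun t ht => hsol.isSymm hA hPT (hsub ht)) htraj z
    simp only [hu, sub_self, zero_dotProduct, intervalIntegral.integral_zero, mul_zero,
      sub_zero] at hid
    linarith

/-! ### Value function and max-plus kernel -/

theorem valueFunction_eq (hsol : IsBivariateRiccatiSolution (timeInterval Tbar T) A C σ P S Q)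
    (hA : StandingAssumptions Tbar T A C σ PT) (hPT : (P T).IsSymm) (hST : IsUnit (S T))
    {t : ℝ} (ht : t ∈ timeInterval Tbar T) (x z : Fin n → ℝ) :
    valueFunction T A C σ (P T) (S T) (Q T) z t x =
      ((bivariateQuadratic (P t) (S t) (Q t) x z : ℝ) : EReal) := by
  have hT := (isGreatest_timeInterval ht).1
  apply le_antisymm
  · refine sSup_le ?_
    rintro _ ⟨u, ξ, htraj, rfl, rfl⟩
    refine EReal.coe_le_coe_iff.2 ?_
    linarith [hsol.runningPayoff_le hA hPT ht hT ht.2 htraj z]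
  · obtain ⟨u, ξ, htraj, hx, -, hpay⟩ :=
      hsol.exists_optimal_trajectory hA hPT hST ht hT ht.2 x z
    refine le_sSup ⟨u, ξ, htraj, hx, ?_⟩
    rw [hpay, hx]
    congr 1
    ring

/-- If `(Q₁ - Q₂)z = 0`, then weak duality along the ray `λz` is affine in `λ`, which forces
`y'S₂z = x'S₁z` whenever `x` can be steered to `y`; by controllability `z = 0`. -/
theorem isUnit_Q_sub (hsol : IsBivariateRiccatiSolution (timeInterval Tbar T) A C σ P S Q)
    (hA : StandingAssumptions Tbar T A C σ PT) (hPT : (P T).IsSymm) (hST : IsUnit (S T))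
    (h₁ : t₁ ∈ timeInterval Tbar T) (h₂ : t₂ ∈ timeInterval Tbar T) (h12 : t₁ < t₂) :
    IsUnit (Q t₁ - Q t₂) := by
  rw [← Matrix.mulVec_injective_iff_isUnit]
  refine (injective_iff_map_eq_zero (Matrix.mulVecLin (Q t₁ - Q t₂))).2 fun z hz => ?_
  rw [Matrix.mulVecLin_apply, Matrix.sub_mulVec, sub_eq_zero] at hz
  have hSz : S t₂ *ᵥ z = 0 := by
    set y := S t₂ *ᵥ z with hy
    obtain ⟨u, ξ, htraj, hx, hy'⟩ := hA.controllable t₁ h₁ t₂ h₂ h12 0 y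
    have hline : ∀ r : ℝ, r * (y ⬝ᵥ y) ≤
        -runningPayoff C t₁ t₂ u ξ - (1 / 2) * (y ⬝ᵥ (P t₂ *ᵥ y)) := by
      intro r
      have h := hsol.runningPayoff_le hA hPT h₁ h₂ h12.le htraj (r • z)
      simp only [bivariateQuadratic, hx, hy', Matrix.mulVec_smul, hz, zero_dotProduct,
        dotProduct_smul, smul_dotProduct, smul_eq_mul, ← hy] at h
      linarith
    by_contra hne
    have hpos : 0 < y ⬝ᵥ y := lt_of_le_of_ne
      (Finset.sum_nonneg fun i _ => mul_self_nonneg _)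
      fun h => hne (dotProduct_self_eq_zero.1 h.symm)
    -- this multiple makes the left side exceed the `r`-independent bound by `1`
    have h := hline ((-runningPayoff C t₁ t₂ u ξ - (1 / 2) * (y ⬝ᵥ (P t₂ *ᵥ y)) + 1) / (y ⬝ᵥ y))
    rw [div_mul_cancel₀ _ hpos.ne'] at h
    linarith
  refine Matrix.mulVec_injective_of_isUnit (hsol.isUnit_S hA hST h₂) ?_
  simp [hSz]

/-- The critical point of `z ↦ V₁(x, z) - V₂(y, z)`: the parameter whose closed loop steers `x`
to `y`. -/
noncomputable def steeringParameter (S Q : ℝ → Matrix (Fin n) (Fin n) ℝ) (t₁ t₂ : ℝ)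
    (x y : Fin n → ℝ) : Fin n → ℝ :=
  (Q t₁ - Q t₂)⁻¹ *ᵥ ((S t₂)ᵀ *ᵥ y - (S t₁)ᵀ *ᵥ x)

theorem exists_steering_trajectory
    (hsol : IsBivariateRiccatiSolution (timeInterval Tbar T) A C σ P S Q)
    (hA : StandingAssumptions Tbar T A C σ PT) (hPT : (P T).IsSymm) (hST : IsUnit (S T))
    (h₁ : t₁ ∈ timeInterval Tbar T) (h₂ : t₂ ∈ timeInterval Tbar T) (h12 : t₁ < t₂)
    (x y : Fin n → ℝ) :
    ∃ (u : ℝ → Fin m → ℝ) (ξ : ℝ → Fin n → ℝ),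
      IsControlledTrajectory A σ t₁ t₂ u ξ ∧ ξ t₁ = x ∧ ξ t₂ = y ∧
      runningPayoff C t₁ t₂ u ξ =
        bivariateQuadratic (P t₁) (S t₁) (Q t₁) x (steeringParameter S Q t₁ t₂ x y) -
          bivariateQuadratic (P t₂) (S t₂) (Q t₂) y (steeringParameter S Q t₁ t₂ x y) := by
  have hG := (Matrix.isUnit_iff_isUnit_det _).1 (hsol.isUnit_Q_sub hA hPT hST h₁ h₂ h12)
  obtain ⟨u, ξ, htraj, hx, hy, hpay⟩ := hsol.exists_optimal_trajectory hA hPT hST h₁ h₂ h12.le x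
    (steeringParameter S Q t₁ t₂ x y)
  have hy' : ξ t₂ = y := hy y <| by
    rw [steeringParameter, Matrix.mulVec_mulVec, Matrix.mul_nonsing_inv _ hG, Matrix.one_mulVec]
    abel
  exact ⟨u, ξ, htraj, hx, hy', by rw [hpay, hx, hy']⟩

theorem maxPlusKernel_eq_sub
    (hsol : IsBivariateRiccatiSolution (timeInterval Tbar T) A C σ P S Q)
    (hA : StandingAssumptions Tbar T A C σ PT) (hPT : (P T).IsSymm) (hST : IsUnit (S T))
    (h₁ : t₁ ∈ timeInterval Tbar T) (h₂ : t₂ ∈ timeInterval Tbar T) (h12 : t₁ < t₂)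
    (x y : Fin n → ℝ) :
    maxPlusKernel A C σ t₁ t₂ x y =
      ((bivariateQuadratic (P t₁) (S t₁) (Q t₁) x (steeringParameter S Q t₁ t₂ x y) -
        bivariateQuadratic (P t₂) (S t₂) (Q t₂) y (steeringParameter S Q t₁ t₂ x y) : ℝ) :
          EReal) := by
  apply le_antisymm
  · refine sSup_le ?_
    rintro _ ⟨u, ξ, htraj, rfl, rfl, rfl⟩
    exact EReal.coe_le_coe_iff.2 (hsol.runningPayoff_le hA hPT h₁ h₂ h12.le htraj _)
  · obtain ⟨u, ξ, htraj, hx, hy, hpay⟩ :=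
      hsol.exists_steering_trajectory hA hPT hST h₁ h₂ h12 x y
    exact le_sSup ⟨u, ξ, htraj, hx, hy, by rw [hpay]⟩

theorem maxPlusKernel_eq_iInf
    (hsol : IsBivariateRiccatiSolution (timeInterval Tbar T) A C σ P S Q)
    (hA : StandingAssumptions Tbar T A C σ PT) (hPT : (P T).IsSymm) (hST : IsUnit (S T))
    (h₁ : t₁ ∈ timeInterval Tbar T) (h₂ : t₂ ∈ timeInterval Tbar T) (h12 : t₁ < t₂)
    (x y : Fin n → ℝ) :
    maxPlusKernel A C σ t₁ t₂ x y =
      ⨅ z, ((bivariateQuadratic (P t₁) (S t₁) (Q t₁) x z -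
        bivariateQuadratic (P t₂) (S t₂) (Q t₂) y z : ℝ) : EReal) := by
  rw [hsol.maxPlusKernel_eq_sub hA hPT hST h₁ h₂ h12]
  obtain ⟨u, ξ, htraj, rfl, rfl, hpay⟩ :=
    hsol.exists_steering_trajectory hA hPT hST h₁ h₂ h12 x y
  refine le_antisymm (le_iInf fun z => ?_) (iInf_le _ _)
  rw [← hpay]
  exact EReal.coe_le_coe_iff.2 (hsol.runningPayoff_le hA hPT h₁ h₂ h12.le htraj z)

end IsBivariateRiccatiSolution

/-- On a degenerate interval the kernel is `0` on the diagonal and `-∞` off it; the infimum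
is `-∞` off the diagonal because `(x - y)'Sz` is then a nonzero linear form in `z`. -/
theorem maxPlusKernel_self_eq_iInf {t : ℝ} (hS : IsUnit (S t)) (x y : Fin n → ℝ) :
    maxPlusKernel A C σ t t x y =
      ⨅ z, ((bivariateQuadratic (P t) (S t) (Q t) x z -
        bivariateQuadratic (P t) (S t) (Q t) y z : ℝ) : EReal) := by
  have hpay : ∀ (u : ℝ → Fin m → ℝ) (ξ : ℝ → Fin n → ℝ), runningPayoff C t t u ξ = 0 :=
    fun u ξ => intervalIntegral.integral_same
  by_cases hxy : x = y
  · subst hxy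
    simp only [sub_self, iInf_const]
    apply le_antisymm
    · refine sSup_le ?_
      rintro _ ⟨u, ξ, -, -, -, rfl⟩
      rw [hpay]
    · refine le_sSup ⟨fun _ => 0, fun _ => x, ⟨MemLp.zero, fun i a ha b hb => ?_⟩, rfl, rfl,
        by rw [hpay]⟩
      rw [Icc_self] at ha hb
      obtain rfl : a = t := ha
      obtain rfl : b = a := hb
      simp
  · have hempty : maxPlusKernel A C σ t t x y = ⊥ := by
      refine sSup_eq_bot.2 ?_
      rintro _ ⟨u, ξ, -, hx, hy, -⟩
      exact absurd (hx.symm.trans hy) hxy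
    rw [hempty, eq_comm, EReal.eq_bot_iff_forall_lt]
    intro r
    have hpos : 0 < (x - y) ⬝ᵥ (x - y) := lt_of_le_of_ne
      (Finset.sum_nonneg fun i _ => mul_self_nonneg _)
      fun h => hxy (sub_eq_zero.1 (dotProduct_self_eq_zero.1 h.symm))
    set c := (1 / 2) * (x ⬝ᵥ (P t *ᵥ x)) - (1 / 2) * (y ⬝ᵥ (P t *ᵥ y)) with hc
    -- the scaling for which the `z` with `Sz = l (x - y)` gives the value `r - 1`
    set l := (r - 1 - c) / ((x - y) ⬝ᵥ (x - y)) with hl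
    refine (iInf_le _ ((S t)⁻¹ *ᵥ (l • (x - y)))).trans_lt (EReal.coe_lt_coe_iff.2 ?_)
    have hSS : S t *ᵥ ((S t)⁻¹ *ᵥ (l • (x - y))) = l • (x - y) := by
      rw [Matrix.mulVec_mulVec, Matrix.mul_nonsing_inv _ ((Matrix.isUnit_iff_isUnit_det _).1 hS),
        Matrix.one_mulVec]
    have hval : l * ((x - y) ⬝ᵥ (x - y)) = r - 1 - c := div_mul_cancel₀ _ hpos.ne'
    rw [sub_dotProduct] at hval
    simp only [bivariateQuadratic, hSS, dotProduct_smul, smul_eq_mul]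
    linarith

/-- Substituting the critical parameter into the difference of the two quadratics leaves
`-½ w'(Q₁ - Q₂)⁻¹w` with `w = S₂'y - S₁'x`, besides the terms in `P`. -/
theorem bivariateQuadratic_sub_steeringParameter {P₁ P₂ S₁ S₂ Q₁ Q₂ : Matrix (Fin n) (Fin n) ℝ}
    (hsymm : (Q₁ - Q₂).IsSymm) (hunit : IsUnit (Q₁ - Q₂)) (x y : Fin n → ℝ) :
    bivariateQuadratic P₁ S₁ Q₁ x ((Q₁ - Q₂)⁻¹ *ᵥ (S₂ᵀ *ᵥ y - S₁ᵀ *ᵥ x)) -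
        bivariateQuadratic P₂ S₂ Q₂ y ((Q₁ - Q₂)⁻¹ *ᵥ (S₂ᵀ *ᵥ y - S₁ᵀ *ᵥ x)) =
      bivariateQuadratic (P₁ - S₁ * (Q₁ - Q₂)⁻¹ * S₁ᵀ) (S₁ * (Q₁ - Q₂)⁻¹ * S₂ᵀ)
        (-P₂ - S₂ * (Q₁ - Q₂)⁻¹ * S₂ᵀ) x y := by
  set H := (Q₁ - Q₂)⁻¹ with hH
  have hHs : Hᵀ = H := by rw [hH, Matrix.transpose_nonsing_inv, hsymm.eq]
  have htr : ∀ (M : Matrix (Fin n) (Fin n) ℝ) (a b : Fin n → ℝ),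
      a ⬝ᵥ (M *ᵥ b) = (Mᵀ *ᵥ a) ⬝ᵥ b := fun M a b => by
    rw [Matrix.dotProduct_mulVec, Matrix.mulVec_transpose]
  set p := S₁ᵀ *ᵥ x with hp
  set q := S₂ᵀ *ᵥ y with hq
  have hcross : q ⬝ᵥ (H *ᵥ p) = p ⬝ᵥ (H *ᵥ q) := by
    rw [htr H q p, hHs, dotProduct_comm]
  have hQ : Q₁ *ᵥ (H *ᵥ (q - p)) = Q₂ *ᵥ (H *ᵥ (q - p)) + (q - p) := by
    have : (Q₁ - Q₂) *ᵥ (H *ᵥ (q - p)) = q - p := by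
      rw [Matrix.mulVec_mulVec, Matrix.mul_nonsing_inv _ ((Matrix.isUnit_iff_isUnit_det _).1 hunit),
        Matrix.one_mulVec]
    rw [Matrix.sub_mulVec] at this
    exact sub_eq_iff_eq_add'.1 this
  have hx : ∀ b, x ⬝ᵥ (S₁ *ᵥ b) = p ⬝ᵥ b := fun b => htr _ _ _
  have hy : ∀ b, y ⬝ᵥ (S₂ *ᵥ b) = q ⬝ᵥ b := fun b => htr _ _ _
  have hw : (H *ᵥ (q - p)) ⬝ᵥ (q - p) = q ⬝ᵥ (H *ᵥ q) - 2 * (p ⬝ᵥ (H *ᵥ q)) + p ⬝ᵥ (H *ᵥ p) := by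
    rw [dotProduct_comm, Matrix.mulVec_sub, sub_dotProduct, dotProduct_sub, dotProduct_sub, hcross]
    ring
  simp only [bivariateQuadratic, hQ, hx, hy, dotProduct_add, hw, Matrix.sub_mulVec,
    Matrix.neg_mulVec, dotProduct_sub, dotProduct_neg, ← Matrix.mulVec_mulVec, ← hp, ← hq]
  simp only [Matrix.mulVec_sub, dotProduct_sub, hcross]
  ring

end TimeInterval

end MaxPlusRiccati

theorem mainTheorem1 {n m : ℕ} (Tbar : EReal) (T : ℝ)
    (A C : ℝ → Matrix (Fin n) (Fin n) ℝ) (σ : ℝ → Matrix (Fin n) (Fin m) ℝ)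
    (PT ST QT : Matrix (Fin n) (Fin n) ℝ)
    (hA1 : MaxPlusRiccati.StandingAssumptions Tbar T A C σ PT)
    (hPT : PT.IsSymm) (hQT : QT.IsSymm) (hST : IsUnit ST) :
    -- the kernel as an infimum of differences of value functions
    (∀ t₁ ∈ MaxPlusRiccati.timeInterval Tbar T, ∀ t₂ ∈ MaxPlusRiccati.timeInterval Tbar T,
      t₁ ≤ t₂ → ∀ x y : Fin n → ℝ,
        MaxPlusRiccati.maxPlusKernel A C σ t₁ t₂ x y =
          ⨅ z : Fin n → ℝ,
            (MaxPlusRiccati.valueFunction T A C σ PT ST QT z t₁ x -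
              MaxPlusRiccati.valueFunction T A C σ PT ST QT z t₂ y)) ∧
    -- the bivariate Riccati equation with the given terminal data is solvable
    (∃ P S Q : ℝ → Matrix (Fin n) (Fin n) ℝ,
      MaxPlusRiccati.IsBivariateRiccatiSolution (MaxPlusRiccati.timeInterval Tbar T) A C σ P S Q ∧
        P T = PT ∧ S T = ST ∧ Q T = QT) ∧
    -- any such solution gives the value function and the kernel
    (∀ P S Q : ℝ → Matrix (Fin n) (Fin n) ℝ,
      MaxPlusRiccati.IsBivariateRiccatiSolution (MaxPlusRiccati.timeInterval Tbar T) A C σ P S Q →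
      P T = PT → S T = ST → Q T = QT →
      (∀ t ∈ MaxPlusRiccati.timeInterval Tbar T, ∀ x z : Fin n → ℝ,
        MaxPlusRiccati.valueFunction T A C σ PT ST QT z t x =
          ((MaxPlusRiccati.bivariateQuadratic (P t) (S t) (Q t) x z : ℝ) : EReal)) ∧
      (∀ t₁ ∈ MaxPlusRiccati.timeInterval Tbar T, ∀ t₂ ∈ MaxPlusRiccati.timeInterval Tbar T,
        t₁ < t₂ →
          IsUnit (Q t₁ - Q t₂) ∧
          ∀ x y : Fin n → ℝ,
            MaxPlusRiccati.maxPlusKernel A C σ t₁ t₂ x y =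
              ((MaxPlusRiccati.bivariateQuadratic
                  (MaxPlusRiccati.kernel11 P S Q t₁ t₂)
                  (MaxPlusRiccati.kernel12 S Q t₁ t₂)
                  (MaxPlusRiccati.kernel22 P S Q t₁ t₂) x y : ℝ) : EReal))) := by
  refine ⟨fun t₁ h₁ t₂ h₂ h12 x y => ?_, hA1.exists_isBivariateRiccatiSolution ST QT,
    fun P S Q hsol hP hS hQ => ?_⟩
  · obtain ⟨P, S, Q, hsol, rfl, rfl, rfl⟩ := hA1.exists_isBivariateRiccatiSolution ST QT
    simp only [hsol.valueFunction_eq hA1 hPT hST h₁, hsol.valueFunction_eq hA1 hPT hST h₂,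
      ← EReal.coe_sub]
    rcases h12.eq_or_lt with rfl | hlt
    · exact MaxPlusRiccati.maxPlusKernel_self_eq_iInf
        (hsol.isUnit_S hA1 hST h₁) x y
    · exact hsol.maxPlusKernel_eq_iInf hA1 hPT hST h₁ h₂ hlt x y
  · subst hP hS hQ
    refine ⟨fun t ht x z => hsol.valueFunction_eq hA1 hPT hST ht x z, fun t₁ h₁ t₂ h₂ h12 => ?_⟩
    have hunit := hsol.isUnit_Q_sub hA1 hPT hST h₁ h₂ h12
    refine ⟨hunit, fun x y => ?_⟩
    rw [hsol.maxPlusKernel_eq_sub hA1 hPT hST h₁ h₂ h12]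
    exact congrArg _ (MaxPlusRiccati.bivariateQuadratic_sub_steeringParameter
      (hsol.isSymm_Q_sub h₁ h₂) hunit x y)
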